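/- Let $m \ge 1$ and let $H_m < H_{m+1} < H_{m+2} < \cdots$ be a strictly increasing sequence of positive integers whose greatest common divisor is $1$. Put $$t(x) = \sum_{i=m}^{\infty} x^{H_i}.$$ For $n \ge 0$ let $c(n)$ be the number of compositions of $n$ (finite ordered sums of positive integers equal to $n$) all of whose summands belong to $\{H_m, H_{m+1}, \dots\}$, and, when $c(n) > 0$, let $\bar c(n)$ be the mean number of summands of such a composition chosen uniformly at random. Then there is exactly one positive real number $\gamma$ for which the series $t(\gamma)$ converges to $1$; it lies in $(0,1)$, $t$ is differentiable at $\gamma$ with $t'(\gamma) > 0$, and, as $n \to \infty$, $$c(n) \sim \frac{1}{t'(\gamma)}\,\gamma^{-n-1}, \qquad \bar c(n) \sim \frac{n}{\gamma\, t'(\gamma)}.$$ (In particular $c(n) > 0$ for all large $n$.) -/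

import Mathlib

open Filter Asymptotics
/-- The power series `t_{H,m}(x) = ∑_{i ≥ m} x ^ (H i)`, as a real function. -/
noncomputable def partSeries (H : ℕ → ℕ) (m : ℕ) (x : ℝ) : ℝ :=
  ∑' i : ℕ, x ^ H (m + i)

open Classical in
/-- The compositions of `n` (ordered sums of positive integers) all of whose summands belong to
`{H m, H (m + 1), …}`. -/
noncomputable def allowedCompositions (H : ℕ → ℕ) (m n : ℕ) : Finset (Composition n) :=
  Finset.univ.filter fun c => ∀ b ∈ c.blocks, ∃ i, m ≤ i ∧ H i = b

/-- The mean number of summands of a uniformly random composition of `n` with summands in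
`{H m, H (m + 1), …}` (with value `0` if there is no such composition). -/
noncomputable def meanSummands (H : ℕ → ℕ) (m n : ℕ) : ℝ :=
  (∑ c ∈ allowedCompositions H m n, (c.length : ℝ)) / ((allowedCompositions H m n).card : ℝ)

/-!
If `γ` is the root of `∑_{k ∈ S} x ^ k = 1`, then the weights `γ ^ k` form a probability
distribution on the set `S` of parts, and the number `c n` of compositions satisfies: `γ ^ n * c n`
is the probability that `n` is a renewal epoch for this distribution. The renewal theorem gives the
limit `1 / μ`, where `μ = γ * t' γ` is the mean part. Splitting a composition at one of its
positions shows that the generating series `L` of the total number of summands is `U ^ 2 - U`, with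
`U` the series of `c`; so `γ ^ n` times its `n`-th coefficient is asymptotic to `n / μ ^ 2`.

The renewal theorem itself is proved by looking at the sequence backward from a time that runs
along an ultrafilter on which the limsup is attained. The limiting past is harmonic for the random
walk and maximal at the origin, hence constant on the additive semigroup generated by `S`, which
contains all large integers. A conservation law then evaluates the constant; applied to `u` and
`-u` this identifies limsup and liminf.
-/

open Topology

section Compositions
open PowerSeries Finset.HasAntidiagonal

open Classical in
/-- The compositions of `n` with parts in `S`. -/
noncomputable def compositionsIn (S : Set ℕ) (n : ℕ) : Finset (Composition n) :=
  Finset.univ.filter fun c => ∀ b ∈ c.blocks, b ∈ S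

variable {S : Set ℕ}

theorem mem_compositionsIn {n : ℕ} {c : Composition n} :
    c ∈ compositionsIn S n ↔ ∀ b ∈ c.blocks, b ∈ S := by
  simp [compositionsIn]

open Classical in
theorem sum_compositionsIn_succ {M : Type*} [AddCommMonoid M] (h0 : 0 ∉ S) (f : List ℕ → M)
    (n : ℕ) :
    ∑ c ∈ compositionsIn S (n + 1), f c.blocks =
      ∑ q ∈ antidiagonal (n + 1) with q.1 ∈ S,
        ∑ c ∈ compositionsIn S q.2, f (q.1 :: c.blocks) := by
  have hpos {k : ℕ} (hk : k ∈ S) : 0 < k := Nat.pos_of_ne_zero fun h => h0 (h ▸ hk)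
  rw [Finset.sum_sigma']
  symm
  refine Finset.sum_bij (fun s hs => ⟨s.1.1 :: s.2.blocks, ?_, ?_⟩) ?_ ?_ ?_ fun _ _ => rfl
  · simp only [Finset.mem_sigma, Finset.mem_filter] at hs
    exact @(List.forall_mem_cons.mpr ⟨hpos hs.1.2, fun _ => s.2.blocks_pos⟩)
  · simp only [Finset.mem_sigma, Finset.mem_filter, mem_antidiagonal] at hs
    rw [List.sum_cons, s.2.blocks_sum, hs.1.1]
  · rintro ⟨⟨k, j⟩, c⟩ hs
    simp only [Finset.mem_sigma, Finset.mem_filter, mem_compositionsIn] at hs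
    exact mem_compositionsIn.mpr (List.forall_mem_cons.mpr ⟨hs.1.2, hs.2⟩)
  · rintro ⟨⟨k, j⟩, c⟩ hs ⟨⟨k', j'⟩, c'⟩ hs' heq
    simp only [Finset.mem_sigma, Finset.mem_filter, mem_antidiagonal] at hs hs'
    obtain ⟨rfl, hblocks⟩ := List.cons.inj (Composition.ext_iff.mp heq)
    obtain rfl : j = j' := Nat.add_left_cancel (hs.1.1.trans hs'.1.1.symm)
    obtain rfl := Composition.ext hblocks
    rfl
  · rintro ⟨_ | ⟨k, l⟩, hl, hsum⟩ hc
    · simp at hsum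
    · have hc := List.forall_mem_cons.mp (mem_compositionsIn.mp hc)
      refine ⟨⟨(k, l.sum), ⟨l, fun hb => hl (List.mem_cons_of_mem _ hb), rfl⟩⟩, ?_, rfl⟩
      simpa only [Finset.mem_sigma, Finset.mem_filter, mem_antidiagonal, mem_compositionsIn,
        ← hsum, List.sum_cons, true_and] using hc

/-- The generating series `∑ₙ (∑_c g (length c)) Xⁿ` over the compositions `c` of `n` with parts
in `S`: it counts the compositions for `g = 1` and their summands for `g = Nat.cast`. -/
noncomputable def lengthSeries {R : Type*} [Semiring R] (S : Set ℕ) (g : ℕ → R) : R⟦X⟧ :=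
  mk fun n => ∑ c ∈ compositionsIn S n, g c.length

theorem lengthSeries_eq_add_mul {R : Type*} [Semiring R] (h0 : 0 ∉ S) (g : ℕ → R) :
    lengthSeries S g =
      C (g 0) + mk (S.indicator 1) * lengthSeries S fun k => g (k + 1) := by
  classical
  ext n
  have hmul : coeff n (mk (S.indicator 1) * lengthSeries S fun k => g (k + 1)) =
      ∑ q ∈ antidiagonal n with q.1 ∈ S,
        ∑ c ∈ compositionsIn S q.2, g (c.length + 1) := by
    simp only [coeff_mul, lengthSeries, coeff_mk, Finset.sum_filter, Set.indicator_apply,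
      Pi.one_apply, ite_mul, one_mul, zero_mul]
  rw [map_add, hmul, lengthSeries, coeff_mk, coeff_C]
  cases n with
  | zero =>
    have hempty : compositionsIn S 0 = {Composition.ones 0} := by
      ext c
      simp [mem_compositionsIn, Composition.eq_ones_iff, c.blocks_eq_nil.mpr rfl]
    simp [hempty, Finset.filter_singleton, h0]
  | succ n =>
    rw [if_neg n.succ_ne_zero, zero_add]
    exact sum_compositionsIn_succ h0 (fun l => g l.length) n

theorem lengthSeries_one_eq {R : Type*} [Semiring R] (h0 : 0 ∉ S) :
    lengthSeries S (1 : ℕ → R) = 1 + mk (S.indicator 1) * lengthSeries S 1 := by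
  simpa using! lengthSeries_eq_add_mul h0 (1 : ℕ → R)

theorem lengthSeries_natCast_eq {R : Type*} [CommRing R] (h0 : 0 ∉ S) :
    lengthSeries S (Nat.cast : ℕ → R) = lengthSeries S 1 * lengthSeries S 1 - lengthSeries S 1 := by
  have hsucc : (lengthSeries S fun k => ((k + 1 : ℕ) : R)) =
      lengthSeries S Nat.cast + lengthSeries S 1 := by
    ext n
    simp [lengthSeries, Finset.sum_add_distrib]
  have hcount := lengthSeries_one_eq (R := R) h0
  have hlength := lengthSeries_eq_add_mul h0 (Nat.cast : ℕ → R)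
  rw [hsucc, Nat.cast_zero, map_zero, zero_add] at hlength
  linear_combination lengthSeries S 1 * hlength -
    (lengthSeries S 1 + lengthSeries S Nat.cast) * hcount

end Compositions

section Renewal
open PowerSeries

/-- The survival function `n ↦ P(K > n)` of a random variable `K` with distribution `p` on `ℕ`. -/
def survival (p : ℕ → ℝ) (n : ℕ) : ℝ :=
  1 - ∑ k ∈ Finset.range (n + 1), p k

theorem hasSum_survival {p : ℕ → ℝ} {μ : ℝ} (hp : ∀ k, 0 ≤ p k) (hsum : HasSum p 1)
    (hmean : HasSum (fun k : ℕ => k * p k) μ) : HasSum (survival p) μ := by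
  -- sum `p (i + j + 1)` over `ℕ × ℕ` along the diagonals `i + j = n` and along the rows
  let f : ℕ × ℕ → ℝ := fun q => p (q.1 + q.2 + 1)
  let e := Finset.HasAntidiagonal.sigmaAntidiagonalEquivProd (A := ℕ)
  have hdiag (n : ℕ) : HasSum (fun q => f (e ⟨n, q⟩)) ((n + 1 : ℕ) * p (n + 1)) := by
    have hconst (q : Finset.HasAntidiagonal.antidiagonal n) : f (e ⟨n, q⟩) = p (n + 1) := by
      simp [f, e, Finset.HasAntidiagonal.mem_antidiagonal.mp q.2]
    simpa [hconst] using hasSum_fintype fun q => f (e ⟨n, q⟩)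
  have hrow (i : ℕ) : HasSum (fun j => f (i, j)) (survival p i) := by
    simpa only [f, survival, add_assoc, add_left_comm] using
      (hasSum_nat_add_iff' (i + 1)).mpr hsum
  have hshift : HasSum (fun n : ℕ => (n + 1 : ℕ) * p (n + 1)) μ := by
    simpa using (hasSum_nat_add_iff' 1).mpr hmean
  have hdouble : HasSum f μ := by
    rw [← e.hasSum_iff]
    have hs : Summable (f ∘ e) := by
      refine (summable_sigma_of_nonneg fun _ => hp _).mpr ⟨fun n => (hdiag n).summable, ?_⟩
      exact hshift.summable.congr fun n => (hdiag n).tsum_eq.symm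
    rw [← (hs.hasSum.sigma hdiag).unique hshift]
    exact hs.hasSum
  exact hdouble.prod_fiberwise hrow

theorem survival_nonneg {p : ℕ → ℝ} (hp : ∀ k, 0 ≤ p k) (hsum : HasSum p 1) (n : ℕ) :
    0 ≤ survival p n :=
  sub_nonneg.mpr (sum_le_hasSum _ (fun k _ => hp k) hsum)

theorem mk_survival (p : ℕ → ℝ) : mk (survival p) = (1 - mk p) * mk 1 := by
  have hpartial (n : ℕ) : coeff n (mk p * mk 1) = ∑ k ∈ Finset.range (n + 1), p k := by
    simp [coeff_mul, Finset.Nat.sum_antidiagonal_eq_sum_range_succ_mk]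
  ext n
  simp [survival, sub_mul, hpartial]

theorem coeff_survival_mul_of_renewal {p x : ℕ → ℝ} {c : ℝ} (hx : mk x = C c + mk p * mk x)
    (n : ℕ) : coeff n (mk (survival p) * mk x) = c := by
  have h : mk (survival p) * mk x = C c * mk 1 := by
    rw [mk_survival]
    linear_combination mk 1 * hx
  simp [h]

/-- The sequence `w` is the past of `x` as seen from the end of the filter `F`:
`x (n - k) → w k` along `F`, for every `k`. The truncation in `n - k` is harmless when
`F ≤ atTop`. -/
def IsBackwardLimit (x : ℕ → ℝ) (F : Filter ℕ) (w : ℕ → ℝ) : Prop :=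
  ∀ k, Tendsto (fun n => x (n - k)) F (𝓝 (w k))

theorem exists_isBackwardLimit {x : ℕ → ℝ} {B : ℝ} (hx : ∀ n, |x n| ≤ B) (F : Ultrafilter ℕ) :
    ∃ w, IsBackwardLimit x F w := by
  have hlim (k : ℕ) : ∃ b, Tendsto (fun n => x (n - k)) F (𝓝 b) := by
    obtain ⟨b, -, hb⟩ := isCompact_Icc.ultrafilter_le_nhds (F.map fun n => x (n - k))
      (tendsto_principal.mpr (Eventually.of_forall fun n => abs_le.mp (hx (n - k))))
    exact ⟨b, hb⟩
  choose w hw using hlim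
  exact ⟨w, hw⟩

theorem tendsto_sub_of_le_atTop {F : Filter ℕ} (hF : F ≤ atTop) (k : ℕ) :
    Tendsto (fun n => n - k) F atTop :=
  (tendsto_sub_atTop_nat k).mono_left hF

namespace IsBackwardLimit

variable {x w : ℕ → ℝ} {F : Filter ℕ} {B : ℝ}

theorem shift (hw : IsBackwardLimit x F w) (k : ℕ) :
    IsBackwardLimit x (F.map fun n => n - k) fun j => w (k + j) := fun j => by
  simpa only [tendsto_map'_iff, Function.comp_def, Nat.sub_sub] using hw (k + j)

theorem mapClusterPt [F.NeBot] (hw : IsBackwardLimit x F w) (hF : F ≤ atTop) (k : ℕ) :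
    MapClusterPt (w k) atTop x :=
  (hw k).mapClusterPt.of_comp (tendsto_sub_of_le_atTop hF k)

theorem summable_mul [F.NeBot] (hw : IsBackwardLimit x F w) (hx : ∀ n, |x n| ≤ B)
    {q : ℕ → ℝ} (hq : Summable q) : Summable fun j => q j * w j := by
  have hw_abs (j : ℕ) : |w j| ≤ B := le_of_tendsto (hw j).abs (Eventually.of_forall fun _ => hx _)
  refine Summable.of_norm_bounded (hq.abs.mul_right B) fun j => ?_
  rw [norm_mul]
  exact mul_le_mul_of_nonneg_left (hw_abs j) (abs_nonneg _)

theorem tendsto_coeff_mul (hw : IsBackwardLimit x F w) (hF : F ≤ atTop) (hx : ∀ n, |x n| ≤ B)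
    {q : ℕ → ℝ} (hq : Summable q) :
    Tendsto (fun n => coeff n (mk q * mk x)) F (𝓝 (∑' j, q j * w j)) := by
  have hcoeff (n : ℕ) : coeff n (mk q * mk x) =
      ∑' j, (Finset.range (n + 1) : Set ℕ).indicator (fun j => q j * x (n - j)) j := by
    simp only [coeff_mul, Finset.Nat.sum_antidiagonal_eq_sum_range_succ_mk, coeff_mk,
      ← sum_eq_tsum_indicator]
  simp only [hcoeff]
  refine tendsto_tsum_of_dominated_convergence (hq.abs.mul_right B) (fun j => ?_)
    (Eventually.of_forall fun n j => ?_)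
  · refine ((hw j).const_mul (q j)).congr' ?_
    filter_upwards [hF (eventually_ge_atTop j)] with n hn
    rw [Set.indicator_of_mem (by simpa [Nat.lt_succ_iff] using hn)]
  · refine (norm_indicator_le_norm_self _ _).trans ?_
    rw [norm_mul]
    exact mul_le_mul_of_nonneg_left (hx _) (abs_nonneg _)

theorem hasSum_of_renewal [F.NeBot] (hw : IsBackwardLimit x F w) (hF : F ≤ atTop)
    (hx : ∀ n, |x n| ≤ B) {p : ℕ → ℝ} (hp : Summable p) {c : ℝ}
    (hrenew : mk x = C c + mk p * mk x) (k : ℕ) :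
    HasSum (fun j => p j * w (k + j)) (w k) := by
  have hFk : F.map (fun n => n - k) ≤ atTop := tendsto_sub_of_le_atTop hF k
  have hstep : ∀ᶠ n in F.map (fun n => n - k), coeff n (mk p * mk x) = x n := by
    filter_upwards [hFk (eventually_ne_atTop 0)] with n hn
    simpa [coeff_C, hn] using (congrArg (coeff n) hrenew).symm
  have hlim := ((hw.shift k).tendsto_coeff_mul hFk hx hp).congr' hstep
  exact ((hw.shift k).summable_mul hx hp).hasSum_iff.mpr
    (tendsto_nhds_unique hlim ((hw.shift k) 0))

end IsBackwardLimit

theorem harmonic_eq_of_mem_closure {p w : ℕ → ℝ} (hp : ∀ k, 0 ≤ p k) (hsum : HasSum p 1)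
    (hw : ∀ k, HasSum (fun j => p j * w (k + j)) (w k)) (hmax : ∀ k, w k ≤ w 0) {n : ℕ}
    (hn : n ∈ AddSubmonoid.closure (Function.support p)) : w n = w 0 := by
  induction hn using AddSubmonoid.closure_induction_right with
  | zero => rfl
  | add_right k _ j hj ih =>
    have hdefect : HasSum (fun j => p j * (w 0 - w (k + j))) 0 := by
      simpa [mul_sub, ih] using (hsum.mul_right (w 0)).sub (hw k)
    have hzero := (hasSum_zero_iff_of_nonneg fun j =>
      mul_nonneg (hp j) (sub_nonneg.mpr (hmax (k + j)))).mp hdefect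
    have := (mul_eq_zero.mp (congrFun hzero j)).resolve_left hj
    linarith

theorem limsup_mul_mean_of_renewal {p x : ℕ → ℝ} {μ c B : ℝ} (hp : ∀ k, 0 ≤ p k)
    (hsum : HasSum p 1) (hmean : HasSum (fun k : ℕ => k * p k) μ)
    (hgcd : Nat.setGcd (Function.support p) = 1) (hx : ∀ n, |x n| ≤ B)
    (hrenew : mk x = C c + mk p * mk x) : limsup x atTop * μ = c := by
  have hle : IsBoundedUnder (· ≤ ·) atTop x := isBoundedUnder_of ⟨B, fun n => (abs_le.mp (hx n)).2⟩
  have hge : IsBoundedUnder (· ≥ ·) atTop x :=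
    isBoundedUnder_of ⟨-B, fun n => (abs_le.mp (hx n)).1⟩
  obtain ⟨F, hF, hlim⟩ :=
    mapClusterPt_iff_ultrafilter.mp (MapClusterPt.limsup hge.isCoboundedUnder_le hle)
  obtain ⟨w, hw⟩ := exists_isBackwardLimit hx F
  have hw0 : w 0 = limsup x atTop := tendsto_nhds_unique (hw 0) hlim
  have hmax (k : ℕ) : w k ≤ w 0 := hw0 ▸ (hw.mapClusterPt hF k).le_limsup hle
  obtain ⟨N, hN⟩ := Nat.exists_mem_closure_of_ge (s := Function.support p)
  have hconst (j : ℕ) : w (N + j) = w 0 :=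
    harmonic_eq_of_mem_closure hp hsum (hw.hasSum_of_renewal hF hx hsum.summable hrenew) hmax
      (hN _ (Nat.le_add_right N j) (hgcd ▸ one_dvd _))
  have htail := hasSum_survival hp hsum hmean
  have hconserved := (hw.shift N).tendsto_coeff_mul (tendsto_sub_of_le_atTop hF N) hx htail.summable
  simp only [coeff_survival_mul_of_renewal hrenew, hconst, tsum_mul_right, htail.tsum_eq,
    tendsto_const_nhds_iff] at hconserved
  rw [← hw0, mul_comm]
  exact hconserved.symm

theorem le_apply_zero_of_renewal {p u : ℕ → ℝ} (hp : ∀ k, 0 ≤ p k) (hsum : HasSum p 1)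
    (hu : ∀ n, 0 ≤ u n) (hrenew : mk u = 1 + mk p * mk u) (n : ℕ) : u n ≤ u 0 := by
  have hconserved := coeff_survival_mul_of_renewal (c := 1) (by simpa using hrenew)
  have hzero : survival p 0 * u 0 = 1 := by simpa using hconserved 0
  have hpos : 0 < survival p 0 :=
    pos_of_mul_pos_left (hzero ▸ one_pos) (hu 0)
  refine le_of_mul_le_mul_left ?_ hpos
  rw [hzero, ← hconserved n, coeff_mul]
  simp only [coeff_mk]
  exact Finset.single_le_sum (f := fun q : ℕ × ℕ => survival p q.1 * u q.2) (a := (0, n))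
    (fun q _ => mul_nonneg (survival_nonneg hp hsum q.1) (hu q.2)) (by simp)

theorem tendsto_of_renewal {p u : ℕ → ℝ} {μ : ℝ} (hp : ∀ k, 0 ≤ p k) (hsum : HasSum p 1)
    (hmean : HasSum (fun k : ℕ => k * p k) μ) (hgcd : Nat.setGcd (Function.support p) = 1)
    (hu : ∀ n, 0 ≤ u n) (hrenew : mk u = 1 + mk p * mk u) : Tendsto u atTop (𝓝 μ⁻¹) := by
  have habs (n : ℕ) : |u n| ≤ u 0 :=
    (abs_of_nonneg (hu n)).trans_le (le_apply_zero_of_renewal hp hsum hu hrenew n)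
  have hneg : mk (-u) = C (-1) + mk p * mk (-u) := by
    have : mk (-u) = -mk u := rfl
    rw [this, map_neg, map_one]
    linear_combination -hrenew
  have hsup := eq_inv_of_mul_eq_one_left <|
    limsup_mul_mean_of_renewal hp hsum hmean hgcd habs (by simpa using hrenew)
  have hinf := limsup_mul_mean_of_renewal hp hsum hmean hgcd (x := -u) (by simpa using habs) hneg
  have hle : IsBoundedUnder (· ≤ ·) atTop u :=
    isBoundedUnder_of ⟨u 0, fun n => (abs_le.mp (habs n)).2⟩
  have hge : IsBoundedUnder (· ≥ ·) atTop u := isBoundedUnder_of ⟨0, hu⟩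
  have hliminf : -liminf u atTop = limsup (-u) atTop :=
    Antitone.map_liminf_of_continuousAt (fun _ _ => neg_le_neg) u continuousAt_neg
      hle.isCoboundedUnder_ge hge
  refine tendsto_of_liminf_eq_limsup ?_ hsup hle hge
  rw [← hliminf] at hinf
  exact eq_inv_of_mul_eq_one_left (by linarith)

end Renewal

section Cesaro

theorem tendsto_sum_range_succ_div {v : ℕ → ℝ} {b : ℝ} (hv : Tendsto v atTop (𝓝 b)) :
    Tendsto (fun n : ℕ => (∑ k ∈ Finset.range (n + 1), v k) / n) atTop (𝓝 b) := by
  have h := hv.cesaro.add (hv.mul tendsto_inv_atTop_nhds_zero_nat)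
  rw [mul_zero, add_zero] at h
  refine h.congr fun n => ?_
  rw [Finset.sum_range_succ]
  ring

theorem tendsto_sum_antidiagonal_mul_div {u v : ℕ → ℝ} {a b : ℝ} (hu : Tendsto u atTop (𝓝 a))
    (hv : Tendsto v atTop (𝓝 b)) :
    Tendsto (fun n : ℕ => (∑ q ∈ Finset.HasAntidiagonal.antidiagonal n, u q.1 * v q.2) / n) atTop
      (𝓝 (a * b)) := by
  obtain ⟨B, hB⟩ := hv.norm.isBoundedUnder_le.bddAbove_range
  have herr : Tendsto (fun n : ℕ => (∑ k ∈ Finset.range (n + 1), (u k - a) * v (n - k)) / n)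
      atTop (𝓝 0) := by
    have h0 : Tendsto (fun n => |u n - a| * B) atTop (𝓝 0) := by
      simpa using (hu.sub_const a).abs.mul_const B
    refine squeeze_zero_norm (fun n => ?_) (tendsto_sum_range_succ_div h0)
    rw [norm_div, Real.norm_natCast]
    gcongr
    refine norm_sum_le_of_le _ fun k _ => ?_
    rw [norm_mul]
    exact mul_le_mul_of_nonneg_left (hB ⟨n - k, rfl⟩) (norm_nonneg _)
  have hsplit (n : ℕ) : ∑ q ∈ Finset.HasAntidiagonal.antidiagonal n, u q.1 * v q.2 =
      a * ∑ k ∈ Finset.range (n + 1), v k +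
        ∑ k ∈ Finset.range (n + 1), (u k - a) * v (n - k) := by
    simp only [Finset.Nat.sum_antidiagonal_eq_sum_range_succ_mk, sub_mul, Finset.sum_sub_distrib,
      ← Finset.mul_sum, Finset.sum_flip, add_sub_cancel]
  simp only [hsplit, add_div, mul_div_assoc]
  simpa only [add_zero] using ((tendsto_sum_range_succ_div hv).const_mul a).add herr

end Cesaro

section PowerSums

variable {S : Set ℕ}

/-- The generating function `x ↦ ∑_{k ∈ S} x ^ k` of the set `S`. -/
noncomputable def setSeries (S : Set ℕ) (x : ℝ) : ℝ :=
  ∑' k : S, x ^ (k : ℕ)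

theorem summable_pow_subtype (S : Set ℕ) {x : ℝ} (hx : |x| < 1) :
    Summable fun k : S => x ^ (k : ℕ) :=
  (summable_geometric_of_abs_lt_one hx).subtype S

theorem summable_mul_pow_pred_subtype (S : Set ℕ) {x : ℝ} (hx : |x| < 1) :
    Summable fun k : S => (k : ℕ) * x ^ ((k : ℕ) - 1) := by
  refine Summable.subtype (f := fun k : ℕ => k * x ^ (k - 1)) ((summable_nat_add_iff 1).mp ?_) S
  simpa [add_mul] using (summable_pow_mul_geometric_of_norm_lt_one 1 hx).add
    (summable_geometric_of_abs_lt_one hx)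

theorem hasDerivAt_setSeries (S : Set ℕ) {x : ℝ} (hx : |x| < 1) :
    HasDerivAt (setSeries S) (∑' k : S, (k : ℕ) * x ^ ((k : ℕ) - 1)) x := by
  obtain ⟨b, hxb, hb1⟩ := exists_between hx
  have hb0 : 0 ≤ b := (abs_nonneg x).trans hxb.le
  refine hasDerivAt_tsum_of_isPreconnected (t := Set.Ioo (-b) b)
    (summable_mul_pow_pred_subtype S (by rwa [abs_of_nonneg hb0])) isOpen_Ioo isPreconnected_Ioo
    (fun k y _ => hasDerivAt_pow (k : ℕ) y) (fun k y hy => ?_) (abs_lt.mp hxb)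
    (summable_pow_subtype S hx) (abs_lt.mp hxb)
  rw [norm_mul, norm_pow, Real.norm_natCast]
  gcongr
  exact (abs_lt.mpr hy).le

theorem hasSum_mul_pow_subtype (S : Set ℕ) {x : ℝ} (hx : |x| < 1) :
    HasSum (fun k : S => (k : ℕ) * x ^ (k : ℕ)) (x * deriv (setSeries S) x) := by
  rw [(hasDerivAt_setSeries S hx).deriv]
  refine ((summable_mul_pow_pred_subtype S hx).hasSum.mul_left x).congr_fun fun k => ?_
  rcases k with ⟨_ | k, hk⟩
  · simp
  · rw [Nat.add_sub_cancel, pow_succ]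
    ring

theorem deriv_setSeries_pos (hS : S.Nonempty) (h0 : 0 ∉ S) {x : ℝ} (hx0 : 0 < x) (hx1 : x < 1) :
    0 < deriv (setSeries S) x := by
  have habs : |x| < 1 := by rwa [abs_of_pos hx0]
  obtain ⟨k, hk⟩ := hS
  rw [(hasDerivAt_setSeries S habs).deriv]
  have hk0 : 0 < k := Nat.pos_of_ne_zero fun h => h0 (h ▸ hk)
  exact (summable_mul_pow_pred_subtype S habs).tsum_pos (fun _ => by positivity) ⟨k, hk⟩
    (by positivity)

theorem setSeries_zero (h0 : 0 ∉ S) : setSeries S 0 = 0 := by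
  have hne (k : S) : (k : ℕ) ≠ 0 := fun h => h0 (h ▸ k.2)
  simp [setSeries, hne]

theorem exists_one_lt_setSeries (hS : S.Nontrivial) :
    ∃ b ∈ Set.Ioo (0 : ℝ) 1, 1 < setSeries S b := by
  obtain ⟨i, hi, j, hj, hij⟩ := hS
  have hlim : Tendsto (fun b : ℝ => b ^ i + b ^ j) (𝓝[<] 1) (𝓝 (1 ^ i + 1 ^ j)) :=
    (Continuous.tendsto (by fun_prop) 1).mono_left nhdsWithin_le_nhds
  have hunit : ∀ᶠ b : ℝ in 𝓝[<] 1, b ∈ Set.Ioo 0 1 := Ioo_mem_nhdsLT one_pos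
  obtain ⟨b, hb, hlt⟩ := (hunit.and (hlim.eventually_const_lt (u := 1) (by norm_num))).exists
  refine ⟨b, hb, hlt.trans_le ?_⟩
  have hle := (summable_pow_subtype S (abs_lt.mpr ⟨by linarith [hb.1], hb.2⟩)).sum_le_tsum
    {⟨i, hi⟩, ⟨j, hj⟩} fun k _ => pow_nonneg hb.1.le _
  rwa [Finset.sum_pair (by simpa using hij)] at hle

theorem exists_hasSum_pow_eq_one (hS : S.Nontrivial) (h0 : 0 ∉ S) :
    ∃ γ ∈ Set.Ioo (0 : ℝ) 1, HasSum (fun k : S => γ ^ (k : ℕ)) 1 := by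
  obtain ⟨b, hb, hbig⟩ := exists_one_lt_setSeries hS
  have habs {x : ℝ} (hx : x ∈ Set.Icc 0 b) : |x| < 1 :=
    abs_lt.mpr ⟨by linarith [hx.1], hx.2.trans_lt hb.2⟩
  have hcont : ContinuousOn (setSeries S) (Set.Icc 0 b) := fun x hx =>
    (hasDerivAt_setSeries S (habs hx)).continuousAt.continuousWithinAt
  obtain ⟨γ, hγ, hγ_one⟩ : (1 : ℝ) ∈ setSeries S '' Set.Icc 0 b :=
    intermediate_value_Icc hb.1.le hcont
      (Set.mem_Icc.mpr ⟨(setSeries_zero h0).trans_le zero_le_one, hbig.le⟩)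
  have hγ_ne : γ ≠ 0 := by
    rintro rfl
    exact zero_ne_one ((setSeries_zero h0).symm.trans hγ_one)
  exact ⟨γ, ⟨hγ.1.lt_of_ne' hγ_ne, hγ.2.trans_lt hb.2⟩,
    (summable_pow_subtype S (habs hγ)).hasSum_iff.mpr hγ_one⟩

theorem hasSum_pow_left_injective (hS : S.Nonempty) (h0 : 0 ∉ S) {x y a : ℝ} (hx : 0 ≤ x)
    (hy : 0 ≤ y) (hxa : HasSum (fun k : S => x ^ (k : ℕ)) a)
    (hya : HasSum (fun k : S => y ^ (k : ℕ)) a) : x = y := by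
  wlog hxy : x ≤ y generalizing x y
  · exact (this hy hx hya hxa (le_of_not_ge hxy)).symm
  obtain ⟨k, hk⟩ := hS
  by_contra hne
  have hlt : x ^ k < y ^ k := pow_lt_pow_left₀ (hxy.lt_of_ne hne) hx fun h => h0 (h ▸ hk)
  exact (hasSum_lt (fun j : S => pow_le_pow_left₀ hx hxy j) (i := ⟨k, hk⟩) hlt hxa hya).false

end PowerSums

section Synthesis

variable {S : Set ℕ} {γ : ℝ}

theorem isEquivalent_const_mul_of_tendsto_div {α 𝕜 : Type*} [NormedField 𝕜] {l : Filter α}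
    {u v : α → 𝕜} {c : 𝕜} (hc : c ≠ 0) (hv : ∀ᶠ a in l, v a ≠ 0)
    (h : Tendsto (fun a => u a / v a) l (𝓝 c)) : u ~[l] fun a => c * v a := by
  have hconst : (fun a => u a / v a) ~[l] Function.const α c :=
    (isEquivalent_const_iff_tendsto hc).mpr h
  refine (hconst.mul (IsEquivalent.refl (u := v))).congr_left ?_
  filter_upwards [hv] with a ha using div_mul_cancel₀ _ ha

theorem rescale_lengthSeries {R : Type*} [CommSemiring R] (g : ℕ → R) (x : R) :
    PowerSeries.rescale x (lengthSeries S g) =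
      PowerSeries.mk fun n => x ^ n * ∑ c ∈ compositionsIn S n, g c.length :=
  PowerSeries.rescale_mk _ _

theorem tendsto_pow_mul_card_compositionsIn (h0 : 0 ∉ S) (hgcd : Nat.setGcd S = 1)
    (hγ : γ ∈ Set.Ioo 0 1) (hγS : HasSum (fun k : S => γ ^ (k : ℕ)) 1) :
    Tendsto (fun n => γ ^ n * (compositionsIn S n).card) atTop
      (𝓝 (γ * deriv (setSeries S) γ)⁻¹) := by
  have habs : |γ| < 1 := by rw [abs_of_pos hγ.1]; exact hγ.2
  let p : ℕ → ℝ := S.indicator fun k => γ ^ k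
  have hsupport : Function.support p = S := by
    ext k
    simp [p, hγ.1.ne']
  have hmean : HasSum (fun k : ℕ => k * p k) (γ * deriv (setSeries S) γ) := by
    have h := (hasSum_subtype_iff_indicator (f := fun k : ℕ => k * γ ^ k)).mp
      (hasSum_mul_pow_subtype S habs)
    exact h.congr_fun fun k => (Set.indicator_mul_right S _ _).symm
  have hrescale : PowerSeries.rescale γ (PowerSeries.mk (S.indicator 1)) = PowerSeries.mk p := by
    ext n
    by_cases hn : n ∈ S <;> simp [p, hn]
  have hrenew := congrArg (PowerSeries.rescale γ) (lengthSeries_one_eq (R := ℝ) h0)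
  rw [map_add, map_mul, map_one, hrescale, rescale_lengthSeries] at hrenew
  simpa using tendsto_of_renewal (Set.indicator_nonneg fun k _ => pow_nonneg hγ.1.le k)
    (hasSum_subtype_iff_indicator (f := fun k => γ ^ k).mp hγS) hmean (hsupport.symm ▸ hgcd)
    (fun n => mul_nonneg (pow_nonneg hγ.1.le n) (by simp)) hrenew

theorem pow_mul_sum_length_compositionsIn {R : Type*} [CommRing R] (h0 : 0 ∉ S) (x : R) (n : ℕ) :
    x ^ n * ∑ c ∈ compositionsIn S n, (c.length : R) =
      ∑ q ∈ Finset.HasAntidiagonal.antidiagonal n,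
          (x ^ q.1 * (compositionsIn S q.1).card) * (x ^ q.2 * (compositionsIn S q.2).card) -
        x ^ n * (compositionsIn S n).card := by
  have h := congrArg (fun L => PowerSeries.coeff n (PowerSeries.rescale x L))
    (lengthSeries_natCast_eq (R := R) h0)
  simpa [rescale_lengthSeries, PowerSeries.coeff_mul] using h

theorem tendsto_pow_mul_sum_length_compositionsIn {a : ℝ} (h0 : 0 ∉ S)
    (hcard : Tendsto (fun n => γ ^ n * (compositionsIn S n).card) atTop (𝓝 a)) :
    Tendsto (fun n => γ ^ n * (∑ c ∈ compositionsIn S n, (c.length : ℝ)) / n) atTop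
      (𝓝 (a * a)) := by
  have h := (tendsto_sum_antidiagonal_mul_div hcard hcard).sub
    (hcard.mul tendsto_inv_atTop_nhds_zero_nat)
  simp only [mul_zero, sub_zero] at h
  refine h.congr fun n => ?_
  rw [pow_mul_sum_length_compositionsIn h0, sub_div, div_eq_mul_inv (γ ^ n * _)]

/-- The mean number of summands of a uniformly random composition of `n` with parts in `S`
(with value `0` if there is no such composition). -/
noncomputable def meanLength (S : Set ℕ) (n : ℕ) : ℝ :=
  (∑ c ∈ compositionsIn S n, (c.length : ℝ)) / (compositionsIn S n).card

theorem card_compositionsIn_isEquivalent {D : ℝ} (hγ : γ ≠ 0) (hD : D ≠ 0)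
    (hcard : Tendsto (fun n => γ ^ n * (compositionsIn S n).card) atTop (𝓝 (γ * D)⁻¹)) :
    (fun n : ℕ => ((compositionsIn S n).card : ℝ)) ~[atTop]
      fun n : ℕ => 1 / D * γ ^ (-(n : ℤ) - 1) := by
  have h := isEquivalent_const_mul_of_tendsto_div (v := fun n => (γ ^ n)⁻¹)
    (u := fun n => ((compositionsIn S n).card : ℝ))
    (inv_ne_zero (mul_ne_zero hγ hD)) (Eventually.of_forall fun n => by positivity)
    (hcard.congr fun n => by rw [div_inv_eq_mul, mul_comm])
  convert! h using 2 with n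
  rw [zpow_sub₀ hγ, zpow_neg, zpow_natCast, zpow_one]
  field_simp

theorem meanLength_isEquivalent {a : ℝ} (h0 : 0 ∉ S) (hγ : γ ≠ 0) (ha : a ≠ 0)
    (hcard : Tendsto (fun n => γ ^ n * (compositionsIn S n).card) atTop (𝓝 a)) :
    meanLength S ~[atTop] fun n : ℕ => a * n := by
  refine isEquivalent_const_mul_of_tendsto_div ha
    ((eventually_ne_atTop 0).mono fun n hn => Nat.cast_ne_zero.mpr hn) ?_
  have h := (tendsto_pow_mul_sum_length_compositionsIn h0 hcard).div hcard ha
  rw [mul_div_cancel_right₀ _ ha] at h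
  refine h.congr fun n => ?_
  rw [Pi.div_apply, meanLength, div_right_comm, mul_div_mul_left _ _ (pow_ne_zero n hγ)]

end Synthesis

theorem theorem3p3_general (S : Set ℕ) (hS : S.Nontrivial) (h0 : 0 ∉ S) (hgcd : Nat.setGcd S = 1) :
    ∃ γ ∈ Set.Ioo (0 : ℝ) 1,
      (∀ x : ℝ, 0 < x → (HasSum (fun k : S => x ^ (k : ℕ)) 1 ↔ x = γ)) ∧
      DifferentiableAt ℝ (setSeries S) γ ∧
      0 < deriv (setSeries S) γ ∧
      (fun n : ℕ => ((compositionsIn S n).card : ℝ)) ~[atTop]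
        (fun n : ℕ => 1 / deriv (setSeries S) γ * γ ^ (-(n : ℤ) - 1)) ∧
      meanLength S ~[atTop] (fun n : ℕ => 1 / (γ * deriv (setSeries S) γ) * (n : ℝ)) := by
  obtain ⟨γ, hγ, hγS⟩ := exists_hasSum_pow_eq_one hS h0
  have hD : 0 < deriv (setSeries S) γ := deriv_setSeries_pos hS.nonempty h0 hγ.1 hγ.2
  have hcard := tendsto_pow_mul_card_compositionsIn h0 hgcd hγ hγS
  refine ⟨γ, hγ, fun x hx => ⟨fun h => ?_, fun h => h ▸ hγS⟩,
    differentiableAt_of_deriv_ne_zero hD.ne', hD,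
    card_compositionsIn_isEquivalent hγ.1.ne' hD.ne' hcard, ?_⟩
  · exact hasSum_pow_left_injective hS.nonempty h0 hx.le hγ.1.le h hγS
  · simpa only [one_div] using
      meanLength_isEquivalent h0 hγ.1.ne' (inv_ne_zero (mul_pos hγ.1 hD).ne') hcard

section Enumeration

variable {H : ℕ → ℕ} {m : ℕ}

theorem injective_add_of_injOn_Ici (hH : Set.InjOn H (Set.Ici m)) :
    Function.Injective fun i => H (m + i) := fun i j h =>
  Nat.add_left_cancel (hH (Nat.le_add_right m i) (Nat.le_add_right m j) h)

theorem range_add_eq_image_Ici (H : ℕ → ℕ) (m : ℕ) :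
    Set.range (fun i => H (m + i)) = H '' Set.Ici m := by
  ext b
  simp [le_iff_exists_add]

theorem hasSum_pow_image_Ici_iff (hH : Set.InjOn H (Set.Ici m)) {x a : ℝ} :
    HasSum (fun k : H '' Set.Ici m => x ^ (k : ℕ)) a ↔ HasSum (fun i => x ^ H (m + i)) a := by
  rw [← range_add_eq_image_Ici]
  exact (injective_add_of_injOn_Ici hH).hasSum_range_iff (f := fun k => x ^ k)

theorem setSeries_image_Ici (hH : Set.InjOn H (Set.Ici m)) :
    setSeries (H '' Set.Ici m) = partSeries H m := by
  ext x
  rw [← range_add_eq_image_Ici]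
  exact tsum_range (fun k => x ^ k) (injective_add_of_injOn_Ici hH)

theorem compositionsIn_image_Ici (n : ℕ) :
    compositionsIn (H '' Set.Ici m) n = allowedCompositions H m n :=
  rfl

theorem meanLength_image_Ici : meanLength (H '' Set.Ici m) = meanSummands H m :=
  rfl

end Enumeration

theorem theorem3p3 (H : ℕ → ℕ) (m : ℕ)
    (hmono : StrictMonoOn H (Set.Ici m))
    (hpos : ∀ i, m ≤ i → 0 < H i)
    (hgcd : ∀ d : ℕ, (∀ i, m ≤ i → d ∣ H i) → d = 1) :
    ∃ γ ∈ Set.Ioo (0 : ℝ) 1,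
      (∀ x : ℝ, 0 < x → (HasSum (fun i : ℕ => x ^ H (m + i)) 1 ↔ x = γ)) ∧
      DifferentiableAt ℝ (partSeries H m) γ ∧
      0 < deriv (partSeries H m) γ ∧
      (fun n : ℕ => ((allowedCompositions H m n).card : ℝ)) ~[atTop]
        (fun n : ℕ => 1 / deriv (partSeries H m) γ * γ ^ (-(n : ℤ) - 1)) ∧
      (fun n : ℕ => meanSummands H m n) ~[atTop]
        (fun n : ℕ => 1 / (γ * deriv (partSeries H m) γ) * (n : ℝ)) := by
  simpa only [setSeries_image_Ici hmono.injOn, hasSum_pow_image_Ici_iff hmono.injOn,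
    compositionsIn_image_Ici, meanLength_image_Ici] using
    theorem3p3_general (H '' Set.Ici m) ((Set.Ici_infinite m).image hmono.injOn).nontrivial
      (fun ⟨i, hi, h⟩ => (hpos i hi).ne' h)
      (hgcd _ fun i hi => Nat.setGcd_dvd_of_mem (Set.mem_image_of_mem H hi))
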